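/- An algebraic circuit over a field $\mathbb{F}$ is a finite layered directed acyclic graph (edges join consecutive layers) with alternating layers of $+$ and $\times$ gates of unbounded fan-in, a single root (the output gate), and leaves labelled by variables or by constants from $\mathbb{F}$; a $+$ (resp. $\times$) gate computes the sum (resp. product) of the polynomials computed by its children, and the circuit computes the polynomial at its root. Its size is the number of vertices, and its depth is the length of a longest path from the root to a leaf. Theorem. There are a polynomial $P$ in four variables with coefficients in $\mathbb{N}$ and a constant $c\in\mathbb{N}$ such that the following holds for every field $\mathbb{F}$ of characteristic zero and all $n,d,k,r,s,\Delta\in\mathbb{N}$. Let $f\in\mathbb{F}[x_1,\dots,x_n,y]$ be a nonzero polynomial with $\deg(f)\le d$ and $\deg_y(f)\le k$, computed by an algebraic circuit of size $s$ and depth $\Delta$. Then every factor of $f$ of the form $y-g(x_1,\dots,x_n)$ with $g\in\mathbb{F}[x_1,\dots,x_n]$ and $\deg(g)=r$ (where $\deg 0:=0$) is computed by an algebraic circuit of size at most $P(s,r^k,d,n)$ and depth at most $\Delta+c$. -/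

import Mathlib

/-- Labels of the vertices of an algebraic circuit over `F` in the variables `σ`: input leaves are
labelled by a variable or by a field constant, the other gates by `+` or `×`. -/
inductive GateLabel (F : Type*) (σ : Type*) where
  | var (i : σ) : GateLabel F σ
  | const (a : F) : GateLabel F σ
  | add : GateLabel F σ
  | mul : GateLabel F σ

/-- Input labels, that is variables and constants. -/
def GateLabel.IsInput {F : Type*} {σ : Type*} : GateLabel F σ → Prop
  | .var _ => True
  | .const _ => True
  | .add => False
  | .mul => False

/-- An algebraic circuit over `F` in the variables `σ`: a finite layered directed acyclic graph with
alternating layers of `+` and `×` gates of unbounded fan-in, whose leaves are labelled by variables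
and constants, and with a single root, the output gate.  Layers are counted from the output gate
downwards. -/
structure AlgCircuit (F : Type*) (σ : Type*) where
  /-- the vertices -/
  V : Type
  /-- there are finitely many vertices -/
  fintypeV : Fintype V
  /-- the label of each vertex -/
  label : V → GateLabel F σ
  /-- the children (the inputs) of each vertex -/
  children : V → Finset V
  /-- the layer of each vertex -/
  layer : V → ℕ
  /-- the output gate -/
  output : V
  layer_output : layer output = 0
  /-- edges join consecutive layers -/
  layer_child : ∀ v, ∀ w ∈ children v, layer w = layer v + 1
  /-- the leaves are exactly the vertices labelled by a variable or a constant -/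
  isInput_iff : ∀ v, (label v).IsInput ↔ children v = ∅
  /-- no `+` gate is a child of a `+` gate and no `×` gate is a child of a `×` gate -/
  alternating : ∀ v, ∀ w ∈ children v, label w ≠ label v
  /-- the output gate is the only root -/
  single_root : ∀ v, v ≠ output → ∃ w, v ∈ children w

namespace AlgCircuit

instance {F : Type*} {σ : Type*} (Φ : AlgCircuit F σ) : Fintype Φ.V := Φ.fintypeV

/-- The size of a circuit is its number of vertices. -/
def size {F : Type*} {σ : Type*} (Φ : AlgCircuit F σ) : ℕ := Fintype.card Φ.V

/-- The depth of a circuit: the largest layer, which is the length of the longest path from the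
output gate to a leaf. -/
def depth {F : Type*} {σ : Type*} (Φ : AlgCircuit F σ) : ℕ := Finset.univ.sup Φ.layer

theorem layer_le_depth {F : Type*} {σ : Type*} (Φ : AlgCircuit F σ) (v : Φ.V) :
    Φ.layer v ≤ Φ.depth :=
  Finset.le_sup (Finset.mem_univ v)

theorem depth_sub_layer_lt {F : Type*} {σ : Type*} (Φ : AlgCircuit F σ) {v w : Φ.V}
    (h : w ∈ Φ.children v) : Φ.depth - Φ.layer w < Φ.depth - Φ.layer v := by
  have h1 := Φ.layer_child v w h
  have h2 := Φ.layer_le_depth w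
  omega

/-- The polynomial computed at a vertex. -/
noncomputable def polyAt {F : Type*} {σ : Type*} [CommSemiring F] (Φ : AlgCircuit F σ) (v : Φ.V) :
    MvPolynomial σ F :=
  match Φ.label v with
  | .var i => MvPolynomial.X i
  | .const a => MvPolynomial.C a
  | .add => ∑ w ∈ (Φ.children v).attach, Φ.polyAt w.1
  | .mul => ∏ w ∈ (Φ.children v).attach, Φ.polyAt w.1
termination_by Φ.depth - Φ.layer v
decreasing_by
  · exact Φ.depth_sub_layer_lt w.2
  · exact Φ.depth_sub_layer_lt w.2

theorem polyAt_eq {F : Type*} {σ : Type*} [CommSemiring F] (Φ : AlgCircuit F σ) (v : Φ.V) :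
    Φ.polyAt v =
      match Φ.label v with
      | .var i => MvPolynomial.X i
      | .const a => MvPolynomial.C a
      | .add => ∑ w ∈ Φ.children v, Φ.polyAt w
      | .mul => ∏ w ∈ Φ.children v, Φ.polyAt w := by
  rw [polyAt]
  cases Φ.label v <;> simp only
  · exact Finset.sum_attach _ _
  · exact Finset.prod_attach _ _

/-- A circuit computes the polynomial found at its output gate. -/
def Computes {F : Type*} {σ : Type*} [CommSemiring F] (Φ : AlgCircuit F σ)
    (f : MvPolynomial σ F) : Prop :=
  Φ.polyAt Φ.output = f

end AlgCircuit

/-! View `f` as a polynomial `p` in `y` over `F[x]`; then `g` is a root of `p`. In characteristic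
zero it is a simple root of some iterated derivative `P` of `p`, so `P'(g)` is nonzero at some point
`a`. On the line `a + T(x - a)`, Newton iteration with the constant slope `P'(g)(a)` gives `g`
modulo `T^(r+1)` as a polynomial `Q` in the `k+1` coefficients of `P`, each centred at its value at
`a`. The centred coefficients are multiples of `T`, so `Q` may be cut off at degree `r`, which
leaves at most `(r+1)^(k+1)` monomials. As `g` has degree at most `r` on the line, the coefficients
of `T^0, …, T^r` in the result sum to `g(x)`, the value at `T = 1`.

Interpolation in `T` and in `y` turns this into a formula in values of `f` at affine substitutions
(`exists_root_representation`). A bounded number of layers above copies of the given circuit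
realises it (`exists_circuit_X_sub_rename`). For `r ≥ 2` and `k ≥ 1`, `(r+1)^(k+1) ≤ (r^k)^4`; for
`r ≤ 1` the factor is affine and is written down directly. On the circuit side the care goes into
keeping layers alternating: `HasCircuit b` records which parent gate is allowed. -/

namespace GateLabel

/-- Transport of gate labels between variable sets; the value at an input label is irrelevant. -/
def relabel {F : Type*} {σ : Type*} (τ : Type*) : GateLabel F σ → GateLabel F τ
  | .var _ => .add
  | .const _ => .add
  | .add => .add
  | .mul => .mul

/-- The gate label coded by a Boolean. -/
def gate {F : Type*} {σ : Type*} : Bool → GateLabel F σ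
  | true => .add
  | false => .mul

theorem not_isInput_iff {F : Type*} {σ : Type*} {l : GateLabel F σ} :
    ¬ l.IsInput ↔ l = .add ∨ l = .mul := by
  cases l <;> simp [IsInput]

theorem not_isInput_relabel {F : Type*} {σ : Type*} (τ : Type*) (l : GateLabel F σ) :
    ¬ (l.relabel τ).IsInput := by
  cases l <;> simp [IsInput, relabel]

theorem relabel_gate {F : Type*} {σ : Type*} (τ : Type*) (b : Bool) :
    (gate b : GateLabel F σ).relabel τ = gate b := by
  cases b <;> rfl

theorem gate_ne_iff {F : Type*} {σ : Type*} {b c : Bool} :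
    (gate b : GateLabel F σ) ≠ gate c ↔ b = !c := by
  cases b <;> cases c <;> simp [gate]

theorem exists_gate_of_not_isInput {F : Type*} {σ : Type*} {l : GateLabel F σ} (h : ¬ l.IsInput) :
    ∃ b, l = gate b := by
  rcases not_isInput_iff.1 h with h | h
  · exact ⟨true, h⟩
  · exact ⟨false, h⟩

end GateLabel

/-! ### Layers of a circuit and elementary circuits -/

namespace AlgCircuit

section Basic

variable {F : Type*} {σ : Type*} (Φ : AlgCircuit F σ)

theorem induction_children {p : Φ.V → Prop} (h : ∀ v, (∀ w ∈ Φ.children v, p w) → p v)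
    (v : Φ.V) : p v := by
  induction hn : Φ.depth - Φ.layer v using Nat.strong_induction_on generalizing v with
  | _ n ih =>
    subst hn
    exact h v fun w hw => ih _ (Φ.depth_sub_layer_lt hw) w rfl

theorem not_isInput_of_mem_children {v w : Φ.V} (h : w ∈ Φ.children v) :
    ¬ (Φ.label v).IsInput := by
  rw [Φ.isInput_iff]
  exact Finset.ne_empty_of_mem h

/-- All gates in one layer carry the same label. -/
theorem label_eq_of_layer_eq {v w : Φ.V} (hv : ¬ (Φ.label v).IsInput) (hw : ¬ (Φ.label w).IsInput)
    (h : Φ.layer v = Φ.layer w) : Φ.label v = Φ.label w := by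
  induction hn : Φ.layer v generalizing v w with
  | zero =>
    have root : ∀ u, Φ.layer u = 0 → u = Φ.output := by
      intro u hu
      by_contra hne
      obtain ⟨x, hx⟩ := Φ.single_root u hne
      have := Φ.layer_child x u hx
      omega
    rw [root v hn, root w (by omega)]
  | succ n ih =>
    have parent : ∀ u, Φ.layer u = n + 1 → ∃ x, u ∈ Φ.children x := by
      intro u hu
      apply Φ.single_root u
      rintro rfl
      have := Φ.layer_output
      omega
    obtain ⟨x, hx⟩ := parent v hn
    obtain ⟨y, hy⟩ := parent w (by omega)
    have lx := Φ.layer_child x v hx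
    have ly := Φ.layer_child y w hy
    have ix := Φ.not_isInput_of_mem_children hx
    have iy := Φ.not_isInput_of_mem_children hy
    have e := ih ix iy (by omega) (by omega)
    have ax := Φ.alternating x v hx
    have ay := Φ.alternating y w hy
    rw [e] at ax
    obtain ⟨a, ha⟩ := GateLabel.exists_gate_of_not_isInput hv
    obtain ⟨b, hb⟩ := GateLabel.exists_gate_of_not_isInput hw
    obtain ⟨c, hc⟩ := GateLabel.exists_gate_of_not_isInput iy
    rw [ha, hc, GateLabel.gate_ne_iff] at ax
    rw [hb, hc, GateLabel.gate_ne_iff] at ay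
    rw [ha, hb, ax, ay]

theorem one_le_size : 1 ≤ Φ.size :=
  Fintype.card_pos_iff.2 ⟨Φ.output⟩

/-- The circuit that consists of one input leaf. -/
def leaf (l : GateLabel F σ) (hl : l.IsInput) : AlgCircuit F σ where
  V := Unit
  fintypeV := inferInstance
  label _ := l
  children _ := ∅
  layer _ := 0
  output := ()
  layer_output := rfl
  layer_child := by simp
  isInput_iff := by simp [hl]
  alternating := by simp
  single_root := fun v hv => absurd rfl hv

/-- The circuit with one `+` or `×` gate at the root and a leaf for each member of a list of
labels. -/
def star {ι : Type} [Fintype ι] [Nonempty ι] (b : Bool) (l : ι → GateLabel F σ)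
    (hl : ∀ i, (l i).IsInput) : AlgCircuit F σ where
  V := Option ι
  fintypeV := inferInstance
  label v := v.elim (GateLabel.gate b) l
  children v := v.elim (Finset.univ.map Function.Embedding.some) fun _ => ∅
  layer v := v.elim 0 fun _ => 1
  output := none
  layer_output := rfl
  layer_child := by
    rintro (_ | v) (_ | w) <;> simp
  isInput_iff := by
    rintro (_ | v)
    · cases b <;> simp [GateLabel.IsInput, GateLabel.gate, Finset.univ_nonempty.ne_empty]
    · simp [hl]
  alternating := by
    rintro (_ | v) (_ | w) <;> simp
    intro h
    have := hl w
    rw [h] at this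
    cases b <;> exact this
  single_root := by
    rintro (_ | v) h
    · exact absurd rfl h
    · exact ⟨none, by simp⟩

end Basic

/-! ### Replacing leaves by circuits -/

section Subst

variable {F : Type*} {σ τ : Type*} (Φ : AlgCircuit F σ) (Γ : Φ.V → AlgCircuit F τ)

open Classical in
/-- Replacement of the leaves of a circuit by circuits. -/
noncomputable def subst (h₁ : ∀ v, ¬ (Φ.label v).IsInput → Subsingleton (Γ v).V)
    (h₂ : ∀ v, ∀ w ∈ Φ.children v, (Φ.label w).IsInput →
      (Γ w).label (Γ w).output ≠ (Φ.label v).relabel τ) : AlgCircuit F τ where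
  -- By `h₁` each gate of `Φ` contributes exactly one vertex; `h₂` keeps the labels alternating
  -- where a leaf is replaced.
  V := Σ v : Φ.V, (Γ v).V
  fintypeV := inferInstance
  label x := if (Φ.label x.1).IsInput then (Γ x.1).label x.2 else (Φ.label x.1).relabel τ
  children x := if (Φ.label x.1).IsInput then
      ((Γ x.1).children x.2).map (Function.Embedding.sigmaMk x.1)
    else (Φ.children x.1).map ⟨fun w => ⟨w, (Γ w).output⟩, fun _ _ h => congrArg Sigma.fst h⟩
  layer x := Φ.layer x.1 + (Γ x.1).layer x.2
  output := ⟨Φ.output, (Γ Φ.output).output⟩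
  layer_output := by simp [layer_output]
  layer_child := by
    rintro ⟨v, a⟩ y hy
    by_cases hv : (Φ.label v).IsInput
    · simp only [hv, if_true, Finset.mem_map] at hy
      obtain ⟨b, hb, rfl⟩ := hy
      have := (Γ v).layer_child a b hb
      change Φ.layer v + (Γ v).layer b = Φ.layer v + (Γ v).layer a + 1
      omega
    · simp only [hv, if_false, Finset.mem_map] at hy
      obtain ⟨w, hw, rfl⟩ := hy
      have := Φ.layer_child v w hw
      have e : a = (Γ v).output := (h₁ v hv).elim _ _
      subst e
      change Φ.layer w + (Γ w).layer (Γ w).output = _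
      simp only [layer_output]
      omega
  isInput_iff := by
    rintro ⟨v, a⟩
    by_cases hv : (Φ.label v).IsInput
    · simp only [hv, if_true, Finset.map_eq_empty]
      exact (Γ v).isInput_iff a
    · simp only [hv, if_false, Finset.map_eq_empty, GateLabel.not_isInput_relabel, false_iff]
      rwa [← Φ.isInput_iff]
  alternating := by
    rintro ⟨v, a⟩ y hy
    by_cases hv : (Φ.label v).IsInput
    · simp only [hv, if_true, Finset.mem_map] at hy
      obtain ⟨b, hb, rfl⟩ := hy
      change (if (Φ.label v).IsInput then (Γ v).label b else (Φ.label v).relabel τ) ≠ _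
      simpa only [hv, if_true] using (Γ v).alternating a b hb
    · simp only [hv, if_false, Finset.mem_map] at hy
      obtain ⟨w, hw, rfl⟩ := hy
      change (if (Φ.label w).IsInput then (Γ w).label (Γ w).output else
        (Φ.label w).relabel τ) ≠ _
      simp only [hv, if_false]
      split_ifs with h
      · exact h₂ v w hw h
      · obtain ⟨p, hp⟩ := GateLabel.exists_gate_of_not_isInput h
        obtain ⟨q, hq⟩ := GateLabel.exists_gate_of_not_isInput hv
        have := Φ.alternating v w hw
        rw [hp, hq, GateLabel.gate_ne_iff] at this
        rwa [hp, hq, GateLabel.relabel_gate, GateLabel.relabel_gate, GateLabel.gate_ne_iff]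
  single_root := by
    rintro ⟨v, a⟩ hne
    by_cases ha : a = (Γ v).output
    · subst ha
      obtain ⟨u, hu⟩ := Φ.single_root v (by rintro rfl; exact hne rfl)
      refine ⟨⟨u, (Γ u).output⟩, ?_⟩
      simp only [Φ.not_isInput_of_mem_children hu, if_false, Finset.mem_map]
      exact ⟨v, hu, rfl⟩
    · by_cases hv : (Φ.label v).IsInput
      · obtain ⟨b, hb⟩ := (Γ v).single_root a ha
        refine ⟨⟨v, b⟩, ?_⟩
        simp only [hv, if_true, Finset.mem_map]
        exact ⟨a, hb, rfl⟩
      · exact absurd ((h₁ v hv).elim _ _) ha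

variable (h₁ : ∀ v, ¬ (Φ.label v).IsInput → Subsingleton (Γ v).V)
  (h₂ : ∀ v, ∀ w ∈ Φ.children v, (Φ.label w).IsInput →
    (Γ w).label (Γ w).output ≠ (Φ.label v).relabel τ)

/-- The vertex of the composed circuit given by a vertex of the circuit inserted at `v`. -/
noncomputable def substVertex (v : Φ.V) (a : (Γ v).V) : (Φ.subst Γ h₁ h₂).V :=
  (⟨v, a⟩ : Σ v : Φ.V, (Γ v).V)

theorem size_subst : (Φ.subst Γ h₁ h₂).size = ∑ v, (Γ v).size :=
  Fintype.card_sigma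

theorem depth_subst_le {D : ℕ} (hD : ∀ v, (Γ v).depth ≤ D) :
    (Φ.subst Γ h₁ h₂).depth ≤ Φ.depth + D := by
  refine Finset.sup_le ?_
  rintro ⟨v, a⟩ -
  exact Nat.add_le_add (Φ.layer_le_depth v) (((Γ v).layer_le_depth a).trans (hD v))

variable [CommSemiring F]

theorem polyAt_subst_of_isInput {v : Φ.V} (hv : (Φ.label v).IsInput) (a : (Γ v).V) :
    (Φ.subst Γ h₁ h₂).polyAt (Φ.substVertex Γ h₁ h₂ v a) = (Γ v).polyAt a := by
  refine (Γ v).induction_children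
    (p := fun a => (Φ.subst Γ h₁ h₂).polyAt (Φ.substVertex Γ h₁ h₂ v a) = (Γ v).polyAt a) (fun a ih => ?_) a
  have hl : (Φ.subst Γ h₁ h₂).label (Φ.substVertex Γ h₁ h₂ v a) = (Γ v).label a := if_pos hv
  have hc : (Φ.subst Γ h₁ h₂).children (Φ.substVertex Γ h₁ h₂ v a) =
    ((Γ v).children a).map (Function.Embedding.sigmaMk v) := if_pos hv
  rw [polyAt_eq, polyAt_eq (Γ v), hl, hc]
  cases (Γ v).label a <;> simp only
  · exact (Finset.sum_map _ _ _).trans (Finset.sum_congr rfl ih)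
  · exact (Finset.prod_map _ _ _).trans (Finset.prod_congr rfl ih)

theorem polyAt_subst (θ : σ → MvPolynomial τ F)
    (hvar : ∀ v i, Φ.label v = .var i → (Γ v).Computes (θ i))
    (hconst : ∀ v c, Φ.label v = .const c → (Γ v).Computes (MvPolynomial.C c)) (v : Φ.V) :
    (Φ.subst Γ h₁ h₂).polyAt (Φ.substVertex Γ h₁ h₂ v (Γ v).output) = MvPolynomial.aeval θ (Φ.polyAt v) := by
  refine Φ.induction_children
    (p := fun v => (Φ.subst Γ h₁ h₂).polyAt (Φ.substVertex Γ h₁ h₂ v (Γ v).output) =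
      MvPolynomial.aeval θ (Φ.polyAt v)) (fun v ih => ?_) v
  by_cases hv : (Φ.label v).IsInput
  · rw [polyAt_subst_of_isInput _ _ _ _ hv, polyAt_eq Φ]
    cases h : Φ.label v with
    | var i => simpa [Computes] using hvar v i h
    | const c => simpa [Computes] using hconst v c h
    | add => rw [h] at hv; exact hv.elim
    | mul => rw [h] at hv; exact hv.elim
  · have hl : (Φ.subst Γ h₁ h₂).label (Φ.substVertex Γ h₁ h₂ v (Γ v).output) = (Φ.label v).relabel τ := if_neg hv
    have hc : (Φ.subst Γ h₁ h₂).children (Φ.substVertex Γ h₁ h₂ v (Γ v).output) = (Φ.children v).map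
        ⟨fun w => ⟨w, (Γ w).output⟩, fun _ _ h => congrArg Sigma.fst h⟩ := if_neg hv
    rw [polyAt_eq, polyAt_eq Φ, hl, hc]
    rcases GateLabel.not_isInput_iff.1 hv with h | h <;> rw [h] <;>
      simp only [GateLabel.relabel]
    · rw [map_sum]
      exact (Finset.sum_map _ _ _).trans (Finset.sum_congr rfl ih)
    · rw [map_prod]
      exact (Finset.prod_map _ _ _).trans (Finset.prod_congr rfl ih)

end Subst

/-! ### Sums, products and affine substitutions of circuits -/

section HasCircuit

variable {F : Type*} {σ τ : Type*} [CommSemiring F]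

/-- The polynomial `p` has a circuit of size at most `s` and depth at most `D` that can be attached
to a gate with label `gate b`. -/
def HasCircuit (b : Bool) (p : MvPolynomial σ F) (s D : ℕ) : Prop :=
  ∃ Φ : AlgCircuit F σ, Φ.Computes p ∧ Φ.size ≤ s ∧ Φ.depth ≤ D ∧
    Φ.label Φ.output ≠ GateLabel.gate b

theorem HasCircuit.mono {b : Bool} {p : MvPolynomial σ F} {s s' D D' : ℕ}
    (h : HasCircuit b p s D) (hs : s ≤ s') (hD : D ≤ D') : HasCircuit b p s' D' := by
  obtain ⟨Φ, h1, h2, h3, h4⟩ := h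
  exact ⟨Φ, h1, h2.trans hs, h3.trans hD, h4⟩

theorem hasCircuit_X (b : Bool) (i : σ) : HasCircuit b (MvPolynomial.X i : MvPolynomial σ F) 1 0 := by
  refine ⟨leaf (.var i) trivial, ?_, le_rfl, ?_, ?_⟩
  · rw [Computes, polyAt_eq]; rfl
  · exact Finset.sup_le fun _ _ => le_rfl
  · cases b <;> simp [leaf, GateLabel.gate]

theorem hasCircuit_C (b : Bool) (c : F) : HasCircuit b (MvPolynomial.C c : MvPolynomial σ F) 1 0 := by
  refine ⟨leaf (.const c) trivial, ?_, le_rfl, ?_, ?_⟩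
  · rw [Computes, polyAt_eq]; rfl
  · exact Finset.sup_le fun _ _ => le_rfl
  · cases b <;> simp [leaf, GateLabel.gate]

/-- Substitution of polynomials with small circuits for the variables. -/
theorem exists_circuit_aeval (Φ : AlgCircuit F σ) (f : MvPolynomial σ F) (hΦ : Φ.Computes f)
    (θ : σ → MvPolynomial τ F) (D : ℕ) (t : Φ.V → ℕ) (ht : ∀ v, 1 ≤ t v)
    (hθ : ∀ v i b, Φ.label v = .var i → (∀ u, v ∈ Φ.children u → Φ.label u = GateLabel.gate b) →
      HasCircuit b (θ i) (t v) D) :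
    ∃ Ψ : AlgCircuit F τ, Ψ.Computes (MvPolynomial.aeval θ f) ∧ Ψ.size ≤ ∑ v, t v ∧
      Ψ.depth ≤ Φ.depth + D ∧
      (¬ (Φ.label Φ.output).IsInput →
        Ψ.label Ψ.output = (Φ.label Φ.output).relabel τ) := by
  -- A leaf may have several parents, but they share a layer and hence a label, so one replacement
  -- circuit suits them all.
  have parent : ∀ v, ∃ b : Bool, ∀ u, v ∈ Φ.children u → Φ.label u = GateLabel.gate b := by
    intro v
    by_cases h : ∃ u, v ∈ Φ.children u
    · obtain ⟨u, hu⟩ := h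
      have iu := Φ.not_isInput_of_mem_children hu
      obtain ⟨b, hb⟩ := GateLabel.exists_gate_of_not_isInput iu
      refine ⟨b, fun u' hu' => ?_⟩
      rw [← hb]
      refine Φ.label_eq_of_layer_eq (Φ.not_isInput_of_mem_children hu') iu ?_
      have := Φ.layer_child u v hu
      have := Φ.layer_child u' v hu'
      omega
    · exact ⟨true, fun u hu => absurd ⟨u, hu⟩ h⟩
  have key : ∀ v, ∃ Γ : AlgCircuit F τ, Γ.size ≤ t v ∧ Γ.depth ≤ D ∧
      (¬ (Φ.label v).IsInput → Subsingleton Γ.V) ∧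
      (∀ u, v ∈ Φ.children u → (Φ.label v).IsInput →
        Γ.label Γ.output ≠ (Φ.label u).relabel τ) ∧
      (∀ i, Φ.label v = .var i → Γ.Computes (θ i)) ∧
      (∀ c, Φ.label v = .const c → Γ.Computes (MvPolynomial.C c)) := by
    intro v
    obtain ⟨b, hb⟩ := parent v
    cases hv : Φ.label v with
    | var i =>
      obtain ⟨Γ, h1, h2, h3, h4⟩ := hθ v i b hv hb
      refine ⟨Γ, h2, h3, fun h => absurd trivial h, fun u hu _ => ?_, fun j hj => ?_,
        fun c hc => by cases hc⟩
      · rwa [hb u hu, GateLabel.relabel_gate]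
      · cases hj; exact h1
    | const c =>
      obtain ⟨Γ, h1, h2, h3, h4⟩ := hasCircuit_C (σ := τ) b c
      refine ⟨Γ, h2.trans (ht v), h3.trans (Nat.zero_le _), fun h => absurd trivial h,
        fun u hu _ => ?_, fun j hj => (by cases hj), fun d hd => ?_⟩
      · rwa [hb u hu, GateLabel.relabel_gate]
      · cases hd; exact h1
    | add =>
      refine ⟨leaf (.const 0) trivial, ht v, Finset.sup_le fun _ _ => Nat.zero_le _,
        fun _ => inferInstanceAs (Subsingleton Unit), fun u hu h => h.elim,
        fun i h => (by cases h), fun i h => (by cases h)⟩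
    | mul =>
      refine ⟨leaf (.const 0) trivial, ht v, Finset.sup_le fun _ _ => Nat.zero_le _,
        fun _ => inferInstanceAs (Subsingleton Unit), fun u hu h => h.elim,
        fun i h => (by cases h), fun i h => (by cases h)⟩
  choose Γ hs hD h₁ h₂ hvar hconst using key
  refine ⟨Φ.subst Γ h₁ fun v w hw hi => h₂ w v hw hi, ?_, ?_, Φ.depth_subst_le Γ _ _ hD, ?_⟩
  · rw [← hΦ]
    exact Φ.polyAt_subst Γ _ _ θ hvar hconst Φ.output
  · rw [size_subst]
    exact Finset.sum_le_sum fun v _ => hs v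
  · intro h
    exact if_neg h

/-- A gate applied to a family of circuits and to one more constant. -/
theorem hasCircuit_star {ι : Type} [Fintype ι] (b : Bool) (c : F) (p : ι → MvPolynomial σ F)
    (s D : ℕ) (hs : 1 ≤ s) (hp : ∀ i, HasCircuit b (p i) s D) :
    ∃ Ψ : AlgCircuit F σ, Ψ.Computes
        (bif b then MvPolynomial.C c + ∑ i, p i else MvPolynomial.C c * ∏ i, p i) ∧
      Ψ.size ≤ Fintype.card ι * s + 2 ∧ Ψ.depth ≤ D + 1 ∧ Ψ.label Ψ.output = GateLabel.gate b := by
  -- The constant leaf keeps the gate from being childless when `ι` is empty. This leaf and the root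
  -- are the `+ 2` in the size.
  let Φ : AlgCircuit F ι := star (ι := Option ι) b (fun o => o.elim (.const c) .var)
    (by rintro (_ | i) <;> trivial)
  let t : Φ.V → ℕ := fun v => (v : Option (Option ι)).elim 1 fun o => o.elim 1 fun _ => s
  let u : Option ι → Φ.V := fun o => (some o : Option (Option ι))
  have hout : Φ.label Φ.output = GateLabel.gate b := rfl
  have hΦ : Φ.Computes
      (bif b then MvPolynomial.C c + ∑ i, MvPolynomial.X i
        else MvPolynomial.C c * ∏ i, MvPolynomial.X i) := by
    have h0 : Φ.polyAt (u none) = MvPolynomial.C c := by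
      rw [polyAt_eq]; rfl
    have h1 : ∀ i, Φ.polyAt (u (some i)) = MvPolynomial.X i := by
      intro i; rw [polyAt_eq]; rfl
    have hch : Φ.children Φ.output = (Finset.univ : Finset (Option ι)).map
      Function.Embedding.some := rfl
    rw [Computes, polyAt_eq, hout, hch]
    cases b
    · simp only [GateLabel.gate, cond_false]
      refine (Finset.prod_map _ _ _).trans ?_
      rw [Fintype.prod_option]
      exact congrArg₂ _ h0 (Finset.prod_congr rfl fun i _ => h1 i)
    · simp only [GateLabel.gate, cond_true]
      refine (Finset.sum_map _ _ _).trans ?_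
      rw [Fintype.sum_option]
      exact congrArg₂ _ h0 (Finset.sum_congr rfl fun i _ => h1 i)
  obtain ⟨Ψ, k1, k2, k3, k4⟩ := exists_circuit_aeval Φ _ hΦ p D t
    (by
      rintro (_ | _ | v)
      · exact le_rfl
      · exact le_rfl
      · exact hs)
    (by
      intro v i b' hv hb'
      match v, hv with
      | none, hv => cases b <;> cases hv
      | some none, hv => cases hv
      | some (some j), hv =>
        cases hv
        have := hb' none (Finset.mem_map_of_mem _ (Finset.mem_univ _))
        have e : b = b' := by
          by_contra hne
          refine GateLabel.gate_ne_iff (F := F) (σ := ι).2 ?_ this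
          revert hne; cases b <;> cases b' <;> simp
        subst e
        exact hp i)
  refine ⟨Ψ, ?_, k2.trans ?_, k3.trans ?_, ?_⟩
  · cases b <;> simpa using k1
  · have e : ∑ v, t v = 1 + (1 + ∑ _i : ι, s) :=
      (Fintype.sum_option _).trans (congrArg _ (Fintype.sum_option _))
    rw [e]
    simp
    omega
  · have : Φ.depth ≤ 1 := Finset.sup_le (by rintro (_ | v) - <;> simp [Φ, star])
    omega
  · rw [k4 (by rw [hout]; cases b <;> exact id), hout, GateLabel.relabel_gate]

theorem hasCircuit_C_add_sum {ι : Type} [Fintype ι] (c : F) (p : ι → MvPolynomial σ F)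
    {s D : ℕ} (hs : 1 ≤ s) (hp : ∀ i, HasCircuit true (p i) s D) :
    HasCircuit false (MvPolynomial.C c + ∑ i, p i) (Fintype.card ι * s + 2) (D + 1) := by
  obtain ⟨Ψ, h1, h2, h3, h4⟩ := hasCircuit_star true c p s D hs hp
  exact ⟨Ψ, h1, h2, h3, by rw [h4]; simp [GateLabel.gate]⟩

theorem hasCircuit_C_mul_prod {ι : Type} [Fintype ι] (c : F) (p : ι → MvPolynomial σ F)
    {s D : ℕ} (hs : 1 ≤ s) (hp : ∀ i, HasCircuit false (p i) s D) :
    HasCircuit true (MvPolynomial.C c * ∏ i, p i) (Fintype.card ι * s + 2) (D + 1) := by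
  obtain ⟨Ψ, h1, h2, h3, h4⟩ := hasCircuit_star false c p s D hs hp
  exact ⟨Ψ, h1, h2, h3, by rw [h4]; simp [GateLabel.gate]⟩

theorem hasCircuit_C_mul (c : F) {p : MvPolynomial σ F} {s D : ℕ} (hs : 1 ≤ s)
    (hp : HasCircuit false p s D) :
    HasCircuit true (MvPolynomial.C c * p) (s + 2) (D + 1) := by
  simpa using hasCircuit_C_mul_prod (ι := Unit) c (fun _ => p) hs fun _ => hp

/-- A forbidden output label is repaired by one gate of the other kind, together with its neutral
constant `0` or `1`. -/
theorem hasCircuit_of_computes (b : Bool) {Φ : AlgCircuit F σ} {p : MvPolynomial σ F}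
    (h : Φ.Computes p) : HasCircuit b p (Φ.size + 2) (Φ.depth + 1) := by
  by_cases hb : Φ.label Φ.output = GateLabel.gate b
  · have h' : HasCircuit (!b) p Φ.size Φ.depth :=
      ⟨Φ, h, le_rfl, le_rfl, by rw [hb, GateLabel.gate_ne_iff, Bool.not_not]⟩
    cases b
    · simpa using hasCircuit_C_add_sum (ι := Unit) 0 (fun _ => p) Φ.one_le_size fun _ => h'
    · simpa using hasCircuit_C_mul_prod (ι := Unit) 1 (fun _ => p) Φ.one_le_size fun _ => h'
  · exact ⟨Φ, h, by omega, by omega, hb⟩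

/-- Affine substitutions in a circuit. -/
theorem exists_circuit_aeval_affine (Φ : AlgCircuit F σ) {f : MvPolynomial σ F}
    (hΦ : Φ.Computes f) (θ : σ → MvPolynomial τ F)
    (hθ : ∀ i, ∃ c l : F, ∃ j, θ i = MvPolynomial.C c ∨
      θ i = MvPolynomial.C c + MvPolynomial.C l * MvPolynomial.X j) :
    ∃ Ψ : AlgCircuit F τ, Ψ.Computes (MvPolynomial.aeval θ f) ∧ Ψ.size ≤ 7 * Φ.size ∧
      Ψ.depth ≤ Φ.depth + 3 := by
  -- The product `l * X j` has size 3, adding `c` gives 5, and a product with `1`, needed under a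
  -- `+` gate, gives 7; each adds one layer.
  have gadget : ∀ i b, HasCircuit b (θ i) 7 3 := by
    intro i b
    obtain ⟨c, l, j, h | h⟩ := hθ i
    · rw [h]
      exact (hasCircuit_C b c).mono (by omega) (by omega)
    · have h1 := hasCircuit_C_mul l le_rfl (hasCircuit_X (F := F) false j)
      have h2 := hasCircuit_C_add_sum (ι := Unit) c (fun _ => _) (by omega) fun _ => h1
      simp only [Finset.univ_unique, Finset.sum_singleton] at h2
      rw [h]
      cases b
      · exact h2.mono (by simp) (by omega)
      · simpa using hasCircuit_C_mul 1 (by simp) h2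
  obtain ⟨Ψ, h1, h2, h3, -⟩ := exists_circuit_aeval Φ f hΦ θ 3 (fun _ => 7)
    (fun _ => by omega) (fun v i b _ _ => gadget i b)
  refine ⟨Ψ, h1, h2.trans (le_of_eq ?_), h3⟩
  simp [size, mul_comm]

end HasCircuit

end AlgCircuit

/-! ### Interpolation -/

/-- The coefficients of a polynomial of degree at most `N` are fixed linear combinations of its
values at `0, …, N`. -/
theorem exists_coeff_eq_sum_eval (F : Type*) [Field F] [CharZero F] (B : Type*) [CommRing B]
    [Algebra F B] (N i : ℕ) :
    ∃ w : Fin (N + 1) → F, ∀ p : Polynomial B, p.natDegree ≤ N →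
      p.coeff i = ∑ j, algebraMap F B (w j) * p.eval (algebraMap F B ((j : ℕ) : F)) := by
  let v : Fin (N + 1) → F := fun j => ((j : ℕ) : F)
  have hv : Set.InjOn v (Finset.univ : Finset (Fin (N + 1))) := by
    intro a _ b _ h
    exact Fin.ext (Nat.cast_injective h)
  -- The weights are the `i`-th coefficients of the Lagrange basis. By linearity it suffices to
  -- check the powers `X ^ m` over `F`.
  refine ⟨fun j => (Lagrange.basis Finset.univ v j).coeff i, fun p hp => ?_⟩
  have key : ∀ m < N + 1, (if i = m then 1 else 0 : F) =
      ∑ j, v j ^ m * (Lagrange.basis Finset.univ v j).coeff i := by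
    intro m hm
    have h := Lagrange.eq_interpolate (f := (Polynomial.X ^ m : Polynomial F)) hv (by
      rw [Polynomial.degree_X_pow, Finset.card_univ, Fintype.card_fin]
      exact_mod_cast hm)
    have h' := congrArg (fun q => Polynomial.coeff q i) h
    simpa [Lagrange.interpolate_apply, Polynomial.coeff_X_pow, Polynomial.finsetSum_coeff,
      ← map_pow, Polynomial.coeff_C_mul] using h'
  have hev : ∀ x, p.eval x = ∑ m ∈ Finset.range (N + 1), p.coeff m * x ^ m := fun x =>
    Polynomial.eval_eq_sum_range' (by omega) x
  simp only [hev, Finset.mul_sum]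
  rw [Finset.sum_comm]
  have hcoeff : p.coeff i =
      ∑ m ∈ Finset.range (N + 1), p.coeff m * algebraMap F B (if i = m then 1 else 0) := by
    by_cases hi : i < N + 1
    · rw [Finset.sum_eq_single i]
      · simp
      · intro m _ hm
        simp [hm.symm]
      · intro h
        exact absurd (Finset.mem_range.2 hi) h
    · rw [Polynomial.coeff_eq_zero_of_natDegree_lt (by omega), Finset.sum_eq_zero]
      intro m hm
      have := Finset.mem_range.1 hm
      rw [if_neg (by omega)]
      simp
  rw [hcoeff]
  refine Finset.sum_congr rfl fun m hm => ?_
  rw [key m (Finset.mem_range.1 hm), map_sum, Finset.mul_sum]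
  refine Finset.sum_congr rfl fun j _ => ?_
  simp only [map_mul, map_pow, v]
  ring

/-! ### Newton iteration and truncation -/

section Newton

variable {F : Type*} [Field F] {A : Type*} [CommRing A] [Algebra F A]

/-- Newton iteration: a simple root is approximated by polynomials in the coefficients. -/
theorem exists_newton_approximation (T : A) {k : ℕ} (P : Polynomial A) (hP : P.natDegree ≤ k)
    (c : Fin (k + 1) → F) {γ : A} (hγ : P.eval γ = 0) {y₀ δ : F} (hδ : δ ≠ 0)
    (hy : T ∣ γ - algebraMap F A y₀)
    (hd : T ∣ P.derivative.eval γ - algebraMap F A δ) (t : ℕ) :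
    ∃ Q : MvPolynomial (Fin (k + 1)) F, T ^ (t + 1) ∣
      MvPolynomial.aeval (fun i : Fin (k + 1) => P.coeff i - algebraMap F A (c i)) Q - γ := by
  induction t with
  | zero =>
    refine ⟨MvPolynomial.C y₀, ?_⟩
    rw [zero_add, pow_one, MvPolynomial.aeval_C, ← dvd_neg, neg_sub]
    exact hy
  | succ t ih =>
    obtain ⟨Q, hQ⟩ := ih
    -- The step `a ↦ a - δ⁻¹ P(a)` avoids dividing by `P'(a)`, so the iterate stays polynomial. It
    -- gains only one power of `T` each time.
    refine ⟨Q - MvPolynomial.C δ⁻¹ *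
      ∑ i : Fin (k + 1), (MvPolynomial.C (c i) + MvPolynomial.X i) * Q ^ (i : ℕ), ?_⟩
    set z : Fin (k + 1) → A := fun i => P.coeff i - algebraMap F A (c i) with hz
    set a := MvPolynomial.aeval z Q with ha
    have hPa : MvPolynomial.aeval z (∑ i : Fin (k + 1),
        (MvPolynomial.C (c i) + MvPolynomial.X i) * Q ^ (i : ℕ)) = P.eval a := by
      rw [Polynomial.eval_eq_sum_range' (show P.natDegree < k + 1 by omega), Finset.sum_range]
      simp [hz, ha]
    obtain ⟨m, hm⟩ := P.binomExpansion γ (a - γ)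
    rw [add_sub_cancel, hγ, zero_add] at hm
    obtain ⟨u, hu⟩ := hQ
    obtain ⟨w, hw⟩ := hd
    rw [map_sub, map_mul, hPa, MvPolynomial.aeval_C, hm, ← ha, hu]
    have hinv : algebraMap F A δ⁻¹ * algebraMap F A δ = 1 := by
      rw [← map_mul, inv_mul_cancel₀ hδ, map_one]
    rw [sub_eq_iff_eq_add] at hw
    -- With `h = T^(t+1) u` and `P'(γ) = δ + T w`, the linear term `h` cancels and the new error is
    -- `-δ⁻¹ (T w h + m h²)`.
    refine ⟨-(algebraMap F A δ⁻¹ * (w * u + m * u ^ 2 * T ^ t)), ?_⟩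
    have e : a = γ + T ^ (t + 1) * u := by rw [← hu]; ring
    rw [e, hw]
    linear_combination (-(T ^ (t + 1) * u)) * hinv

/-- Truncation of a polynomial in multiples of `T`. -/
theorem exists_totalDegree_le_dvd_sub {σ : Type*} (T : A) (z : σ → A) (hz : ∀ i, T ∣ z i)
    (Q : MvPolynomial σ F) (t : ℕ) :
    ∃ Q' : MvPolynomial σ F, Q'.totalDegree ≤ t ∧
      T ^ (t + 1) ∣ MvPolynomial.aeval z Q - MvPolynomial.aeval z Q' := by
  induction Q using MvPolynomial.monomial_add_induction_on with
  | C a => exact ⟨MvPolynomial.C a, by simp, by simp⟩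
  | monomial_add e a Q _ _ ih =>
    obtain ⟨Q', h1, h2⟩ := ih
    by_cases he : (e.sum fun _ n => n) ≤ t
    · refine ⟨MvPolynomial.monomial e a + Q', ?_, by simpa using h2⟩
      refine (MvPolynomial.totalDegree_add _ _).trans (max_le ?_ h1)
      exact (MvPolynomial.totalDegree_monomial_le _ _).trans he
    -- A monomial of degree above `t` in multiples of `T` is divisible by `T^(t+1)` and is dropped.
    · refine ⟨Q', h1, ?_⟩
      rw [map_add, add_sub_assoc]
      refine dvd_add ?_ h2
      rw [MvPolynomial.aeval_monomial]
      refine Dvd.dvd.mul_left ((pow_dvd_pow T (show t + 1 ≤ e.sum fun _ n => n by omega)).trans ?_) _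
      rw [Finsupp.sum, ← Finset.prod_pow_eq_pow_sum]
      exact Finset.prod_dvd_prod_of_dvd _ _ fun i _ => pow_dvd_pow_of_dvd (hz i) _

end Newton

theorem card_support_le_of_totalDegree_le {R : Type*} [CommSemiring R] {m t : ℕ}
    (Q : MvPolynomial (Fin m) R) (hQ : Q.totalDegree ≤ t) : Q.support.card ≤ (t + 1) ^ m := by
  have h : Q.support.card ≤
      (Fintype.piFinset fun _ : Fin m => Finset.range (t + 1)).card := by
    refine Finset.card_le_card_of_injOn (fun e => (e : Fin m → ℕ)) ?_ ?_
    · intro e he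
      simp only [Finset.mem_coe, Fintype.mem_piFinset, Finset.mem_range]
      intro i
      have h1 := MvPolynomial.degreeOf_le_totalDegree Q i
      have h2 := MvPolynomial.monomial_le_degreeOf i he
      omega
    · intro e _ e' _ h
      exact DFunLike.coe_injective h
  simpa using h

theorem natDegree_aeval_le {R S σ : Type*} [CommRing R] [CommRing S] [Algebra R S]
    {m n : ℕ} (Q : MvPolynomial σ R) (hQ : Q.totalDegree ≤ m) (z : σ → Polynomial S)
    (hz : ∀ i, (z i).natDegree ≤ n) : (MvPolynomial.aeval z Q).natDegree ≤ m * n := by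
  rw [← MvPolynomial.aeval_map_algebraMap S]
  refine MvPolynomial.aeval_natDegree_le _ ?_ z hz
  exact (Finset.sup_mono (MvPolynomial.support_map_subset _ _)).trans hQ

/-- Otherwise all iterated derivatives vanish at `x`, which in characteristic zero contradicts
finite multiplicity. -/
theorem exists_iterate_derivative_simple_root {R : Type*} [CommRing R] [IsDomain R] [CharZero R]
    {p : Polynomial R} (hp : p ≠ 0) {x : R} (hx : p.eval x = 0) :
    ∃ m, (Polynomial.derivative^[m] p).eval x = 0 ∧
      (Polynomial.derivative (Polynomial.derivative^[m] p)).eval x ≠ 0 := by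
  by_contra! h
  have all : ∀ m, (Polynomial.derivative^[m] p).IsRoot x := by
    intro m
    induction m with
    | zero => exact hx
    | succ m ih =>
      rw [Function.iterate_succ_apply']
      exact h m ih
  exact lt_irrefl _ (Polynomial.lt_rootMultiplicity_of_isRoot_iterate_derivative
    (n := p.rootMultiplicity x) hp fun m _ => all m)

/-! ### Restriction to a line and the formula for the root -/

section Line

open MvPolynomial

variable {F : Type*} [Field F] {σ : Type*}

/-- The restriction of a polynomial to the line through `a` and a generic point. -/
noncomputable def lineRestriction (a : σ → F) :
    MvPolynomial σ F →ₐ[F] Polynomial (MvPolynomial (Option σ) F) :=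
  aeval fun i => Polynomial.C (C (a i)) +
    Polynomial.X * Polynomial.C (X (some i) - C (a i))

/-- Substitution of the point with parameter `l` on the line for `x`, and of `b` for `y`. -/
noncomputable def linePoint (a : σ → F) (l b : F) : Option σ → MvPolynomial (Option σ) F
  | none => C b
  | some i => C (a i - l * a i) + C l * X (some i)

theorem eval_lineRestriction (a : σ → F) (l b : F) (q : MvPolynomial σ F) :
    (lineRestriction a q).eval (C l) = aeval (fun i => linePoint a l b (some i)) q := by
  have h : ((Polynomial.aeval (C l : MvPolynomial (Option σ) F)).restrictScalars F).comp
      (lineRestriction a) = aeval (fun i => linePoint a l b (some i)) := by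
    apply algHom_ext
    intro i
    simp [lineRestriction, linePoint]
    ring
  exact DFunLike.congr_fun h q

theorem eval_one_lineRestriction (a : σ → F) (q : MvPolynomial σ F) :
    (lineRestriction a q).eval 1 = rename some q := by
  rw [← C_1, eval_lineRestriction a 1 0]
  have h : (fun i => linePoint a 1 0 (some i)) = fun i => X (some i) := by
    funext i
    simp [linePoint]
  rw [h]
  exact (DFunLike.congr_fun (algHom_ext (f := rename some) (g := aeval fun i => X (some i))
    fun i => by simp) q).symm

/-- The line passes through `a` at parameter `0`. This supplies the divisibility by `T` in both the
Newton iteration and the truncation. -/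
theorem X_dvd_lineRestriction_sub (a : σ → F) (q : MvPolynomial σ F) :
    Polynomial.X ∣ lineRestriction a q - algebraMap F _ (eval a q) := by
  rw [Polynomial.X_dvd_iff, Polynomial.coeff_sub, Polynomial.coeff_zero_eq_eval_zero,
    ← C_0, eval_lineRestriction a 0 0, C_0, sub_eq_zero]
  rw [Polynomial.algebraMap_apply, Polynomial.coeff_C_zero, algebraMap_eq]
  induction q using MvPolynomial.induction_on <;> simp_all [linePoint]

theorem natDegree_lineRestriction_le (a : σ → F) (q : MvPolynomial σ F) :
    (lineRestriction a q).natDegree ≤ q.totalDegree := by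
  have := natDegree_aeval_le (S := MvPolynomial (Option σ) F) (n := 1) q le_rfl
    (fun i => Polynomial.C (C (a i)) + Polynomial.X * Polynomial.C (X (some i) - C (a i)))
    (fun i => by
      rw [Polynomial.X_mul_C]
      refine (Polynomial.natDegree_add_le _ _).trans (max_le ?_ ?_)
      · simp
      · exact Polynomial.natDegree_C_mul_le _ _ |>.trans Polynomial.natDegree_X_le)
  simpa [lineRestriction] using this

/-- Affine substitutions into `f` are thus the values at `y = b` of a polynomial whose coefficients
are those of `f` on the line, so interpolation in `y` recovers these coefficients. -/
theorem aeval_linePoint (a : σ → F) (l b : F) (f : MvPolynomial (Option σ) F) :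
    aeval (linePoint a l b) f = ((optionEquivLeft F σ f).map
      ((aeval fun i => linePoint a l b (some i) :
        MvPolynomial σ F →ₐ[F] MvPolynomial (Option σ) F) :
          MvPolynomial σ F →+* MvPolynomial (Option σ) F)).eval (C b) := by
  induction f using MvPolynomial.induction_on with
  | C c => simp
  | add p q hp hq => rw [map_add, map_add, hp, hq, Polynomial.map_add, Polynomial.eval_add]
  | mul_X p i hp =>
    rw [map_mul, map_mul, hp, Polynomial.map_mul, Polynomial.eval_mul]
    cases i <;> simp [linePoint]

theorem eval_optionEquivLeft_eq_zero {g : MvPolynomial σ F} {f : MvPolynomial (Option σ) F}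
    (h : (X none - rename some g) ∣ f) : (optionEquivLeft F σ f).eval g = 0 := by
  have e : optionEquivLeft F σ (X none - rename some g) = Polynomial.X - Polynomial.C g := by
    rw [map_sub, optionEquivLeft_X_none]
    congr 1
    clear h
    induction g using MvPolynomial.induction_on <;> simp_all
  obtain ⟨u, rfl⟩ := h
  simp [e]

/-- A root of a bivariate polynomial as a small polynomial expression in restrictions of it. -/
theorem exists_root_representation [CharZero F] {d k r : ℕ} {f : MvPolynomial (Option σ) F}
    {g : MvPolynomial σ F} (hf : f ≠ 0) (hd : f.totalDegree ≤ d) (hk : f.degreeOf none ≤ k)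
    (hdvd : (X none - rename some g) ∣ f) (hr : g.totalDegree ≤ r) :
    ∃ (a : σ → F) (Q : MvPolynomial (Fin (k + 1)) F) (α : Fin (k + 1) → Fin (k + 1) → F)
      (c : Fin (k + 1) → F) (W : Fin (r * d + 1) → F), Q.totalDegree ≤ r ∧
      rename some g = ∑ l, C (W l) * aeval (fun i => C (c i) +
        ∑ j, C (α i j) * aeval (linePoint a (((l : ℕ) : F)) ((j : ℕ) : F)) f) Q := by
  classical
  set p := optionEquivLeft F σ f with hp
  have hp0 : p ≠ 0 := by simpa [hp] using hf
  obtain ⟨m, hm0, hm1⟩ := exists_iterate_derivative_simple_root hp0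
    (eval_optionEquivLeft_eq_zero hdvd)
  set P := Polynomial.derivative^[m] p with hP
  have hPdeg : P.natDegree ≤ k := by
    refine ((Polynomial.natDegree_iterate_derivative p m).trans (Nat.sub_le _ _)).trans ?_
    rwa [hp, natDegree_optionEquivLeft]
  obtain ⟨a, ha⟩ : ∃ a, eval a (P.derivative.eval g) ≠ 0 := by
    by_contra! h
    exact hm1 (MvPolynomial.funext fun x => by rw [h x, map_zero])
  let L : MvPolynomial σ F →+* Polynomial (MvPolynomial (Option σ) F) := lineRestriction a
  let c : Fin (k + 1) → F := fun i => eval a (P.coeff i)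
  let z : Fin (k + 1) → Polynomial (MvPolynomial (Option σ) F) :=
    fun i => L (P.coeff i) - algebraMap F _ (c i)
  have hroot : (P.map L).eval (L g) = 0 := by
    rw [Polynomial.eval_map, Polynomial.eval₂_hom, hm0, map_zero]
  have hder : (P.map L).derivative.eval (L g) = L (P.derivative.eval g) := by
    rw [Polynomial.derivative_map, Polynomial.eval_map, Polynomial.eval₂_hom]
  obtain ⟨Q₀, hQ₀⟩ := exists_newton_approximation (F := F) Polynomial.X (P.map L)
    (Polynomial.natDegree_map_le.trans hPdeg) c hroot ha (X_dvd_lineRestriction_sub a g)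
    (by rw [hder]; exact X_dvd_lineRestriction_sub a _) r
  simp only [Polynomial.coeff_map] at hQ₀
  obtain ⟨Q, hQr, hQ⟩ := exists_totalDegree_le_dvd_sub Polynomial.X z
    (fun i => X_dvd_lineRestriction_sub a _) Q₀ r
  have hzdeg : ∀ i, (z i).natDegree ≤ d := by
    intro i
    refine (Polynomial.natDegree_sub_le _ _).trans (max_le ?_ ?_)
    · refine (natDegree_lineRestriction_le a _).trans ?_
      rw [hP, Polynomial.coeff_iterate_derivative]
      refine (totalDegree_smul_le _ _).trans ?_
      exact (totalDegree_coeff_optionEquivLeft_le _ _ _ _).trans hd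
    · rw [Polynomial.algebraMap_apply, Polynomial.natDegree_C]
      exact Nat.zero_le _
  have hdeg : (aeval z Q).natDegree ≤ r * d := natDegree_aeval_le Q hQr z hzdeg
  have hcoeff : ∀ i ∈ Finset.range (r + 1), (L g).coeff i = (aeval z Q).coeff i := by
    intro i hi
    have h := (dvd_sub hQ₀ hQ)
    rw [sub_sub_sub_cancel_left, Polynomial.X_pow_dvd_iff] at h
    have := h i (Finset.mem_range.1 hi)
    rw [Polynomial.coeff_sub, sub_eq_zero] at this
    exact this.symm
  choose w hw using fun i =>
    exists_coeff_eq_sum_eval F (MvPolynomial (Option σ) F) (r * d) i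
  choose w' hw' using fun i =>
    exists_coeff_eq_sum_eval F (MvPolynomial (Option σ) F) k i
  -- Coefficient `i` of the `m`-th derivative is `(i+m).descFactorial m` times coefficient `i+m` of
  -- `p`. The weights for `T^0, …, T^r` are added up because `g` is the value at `T = 1`.
  refine ⟨a, Q, fun i j => (((i + m : ℕ).descFactorial m : ℕ) : F) * w' (i + m) j,
    fun i => - c i, fun l => ∑ i ∈ Finset.range (r + 1), w i l, hQr, ?_⟩
  have hval : ∀ l : F, (aeval z Q).eval (C l) = aeval (fun i : Fin (k + 1) => C (- c i) +
      ∑ j, C ((((i + m : ℕ).descFactorial m : ℕ) : F) * w' (i + m) j) *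
        aeval (linePoint a l ((j : ℕ) : F)) f) Q := by
    intro l
    have h1 : (aeval z Q).eval (C l) = aeval (fun i => (z i).eval (C l)) Q := by
      have h : ((Polynomial.aeval (C l : MvPolynomial (Option σ) F)).restrictScalars F).comp
          (aeval z) = aeval (fun i => (z i).eval (C l)) := by
        apply algHom_ext
        intro i
        simp
      exact DFunLike.congr_fun h Q
    rw [h1]
    congr 2
    funext i
    have h2 : (z i).eval (C l) = (L (P.coeff i)).eval (C l) - C (c i) := by
      simp [z, Polynomial.algebraMap_apply]
    rw [h2, hP, Polynomial.coeff_iterate_derivative]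
    have h3 : (L (p.coeff (i + m))).eval (C l) =
        ∑ j, C (w' (i + m) j) * aeval (linePoint a l ((j : ℕ) : F)) f := by
      have h4 := hw' (i + m) (p.map ((aeval fun i => linePoint a l 0 (some i) :
        MvPolynomial σ F →ₐ[F] MvPolynomial (Option σ) F) :
          MvPolynomial σ F →+* MvPolynomial (Option σ) F))
        (Polynomial.natDegree_map_le.trans (by rwa [hp, natDegree_optionEquivLeft]))
      rw [Polynomial.coeff_map] at h4
      refine (eval_lineRestriction a l 0 _).trans (h4.trans ?_)
      refine Finset.sum_congr rfl fun j _ => ?_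
      rw [aeval_linePoint]
      rfl
    rw [nsmul_eq_mul, map_mul, Polynomial.eval_mul, h3, map_natCast, Polynomial.eval_natCast,
      map_neg, Finset.mul_sum]
    rw [sub_eq_neg_add]
    congr 1
    refine Finset.sum_congr rfl fun j _ => ?_
    rw [C_mul, map_natCast, mul_assoc]
  have hLg : (L g).natDegree < r + 1 :=
    Nat.lt_succ_of_le ((natDegree_lineRestriction_le a g).trans hr)
  calc rename some g = (L g).eval 1 := (eval_one_lineRestriction a g).symm
    _ = ∑ i ∈ Finset.range (r + 1), (aeval z Q).coeff i := by
      rw [Polynomial.eval_eq_sum_range' hLg]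
      refine Finset.sum_congr rfl fun i hi => ?_
      rw [hcoeff i hi, one_pow, mul_one]
    _ = ∑ i ∈ Finset.range (r + 1), ∑ l, C (w i l) * (aeval z Q).eval (C ((l : ℕ) : F)) :=
      Finset.sum_congr rfl fun i _ => hw i _ hdeg
    _ = _ := by
      rw [Finset.sum_comm]
      refine Finset.sum_congr rfl fun l _ => ?_
      rw [← hval, map_sum, Finset.sum_mul]

end Line

/-! ### Circuits for the factor and the size bound -/

namespace AlgCircuit

open MvPolynomial

variable {F : Type*} {τ : Type*}

theorem hasCircuit_aeval [CommSemiring F] {m r M s D : ℕ} (Q : MvPolynomial (Fin m) F)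
    (hr : Q.totalDegree ≤ r) (hM : Q.support.card ≤ M) (z : Fin m → MvPolynomial τ F)
    (hs : 1 ≤ s) (hz : ∀ i, HasCircuit false (z i) s D) :
    HasCircuit false (aeval z Q) (M * (r * s + 2) + 2) (D + 2) := by
  -- Indexing by `Σ i, Fin (e.1 i)` gives each repeated factor its own copy, since the children of a
  -- gate form a set.
  have hmon : ∀ e : Q.support, HasCircuit true
      (C (coeff e.1 Q) * ∏ x : Σ i : Fin m, Fin (e.1 i), z x.1) (r * s + 2) (D + 1) := by
    intro e
    have hprod := hasCircuit_C_mul_prod (coeff e.1 Q)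
      (fun x : Σ i : Fin m, Fin (e.1 i) => z x.1) hs fun x => hz x.1
    refine hprod.mono ?_ le_rfl
    have h : (e.1.sum fun _ n => n) ≤ r := (le_totalDegree e.2).trans hr
    rw [Finsupp.sum_fintype _ _ fun _ => rfl] at h
    rw [Fintype.card_sigma]
    simp only [Fintype.card_fin]
    exact Nat.add_le_add_right (Nat.mul_le_mul_right s h) 2
  have h := hasCircuit_C_add_sum 0 _ (by omega) hmon
  have e : aeval z Q = C 0 + ∑ e : Q.support,
      C (coeff e.1 Q) * ∏ x : Σ i : Fin m, Fin (e.1 i), z x.1 := by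
    rw [aeval_def, eval₂_eq', C_0, zero_add, ← Finset.sum_coe_sort]
    refine Finset.sum_congr rfl fun e _ => ?_
    rw [Fintype.prod_sigma]
    simp [algebraMap_eq]
  rw [e]
  refine h.mono ?_ le_rfl
  rw [Fintype.card_coe]
  gcongr

/-- Extra depth: 4 for an affine sample of `f` with an admissible top gate, 2 for the combination
over `y`, 2 for `Q` as a sum of monomials, 2 for the combination over `T`. -/
theorem exists_circuit_X_sub_rename [Field F] [CharZero F] {n d k r : ℕ}
    {f : MvPolynomial (Option (Fin n)) F} {g : MvPolynomial (Fin n) F}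
    (Φ : AlgCircuit F (Option (Fin n))) (hΦ : Φ.Computes f) (hf : f ≠ 0)
    (hd : f.totalDegree ≤ d) (hk : f.degreeOf none ≤ k)
    (hdvd : (X none - rename some g) ∣ f) (hr : g.totalDegree ≤ r) :
    ∃ Ψ : AlgCircuit F (Option (Fin n)), Ψ.Computes (X none - rename some g) ∧
      Ψ.size ≤ (r * d + 2) *
        ((r + 1) ^ (k + 1) * (r * ((k + 1) * (7 * Φ.size + 4) + 2) + 2) + 4) + 2 ∧
      Ψ.depth ≤ Φ.depth + 10 := by
  obtain ⟨a, Q, α, c, W, hQ, hg⟩ := exists_root_representation hf hd hk hdvd hr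
  have h₁ : ∀ l b : F, HasCircuit false (aeval (linePoint a l b) f)
      (7 * Φ.size + 2) (Φ.depth + 4) := by
    intro l b
    obtain ⟨Ψ, h1, h2, h3⟩ := exists_circuit_aeval_affine Φ hΦ (linePoint a l b) (by
      rintro (_ | i)
      · exact ⟨b, 0, none, Or.inl rfl⟩
      · exact ⟨_, _, _, Or.inr rfl⟩)
    exact (hasCircuit_of_computes false h1).mono (by omega) (by omega)
  have h₂ : ∀ (l : F) (i : Fin (k + 1)), HasCircuit false
      (C (c i) + ∑ j : Fin (k + 1), C (α i j) * aeval (linePoint a l ((j : ℕ) : F)) f)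
      ((k + 1) * (7 * Φ.size + 4) + 2) (Φ.depth + 6) := by
    intro l i
    simpa using hasCircuit_C_add_sum (c i) _ (by omega) fun j : Fin (k + 1) =>
      hasCircuit_C_mul (α i j) (by omega) (h₁ l ((j : ℕ) : F))
  have h₃ := fun l : F => hasCircuit_aeval Q hQ (card_support_le_of_totalDegree_le Q hQ) _
    (by omega) (h₂ l)
  set B := (r + 1) ^ (k + 1) * (r * ((k + 1) * (7 * Φ.size + 4) + 2) + 2) + 4 with hB
  have h₄ : ∀ o : Option (Fin (r * d + 1)), HasCircuit true
      (o.elim (X none) fun l => C (- W l) * aeval (fun i => C (c i) + ∑ j : Fin (k + 1),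
        C (α i j) * aeval (linePoint a ((l : ℕ) : F) ((j : ℕ) : F)) f) Q)
      B (Φ.depth + 9) := by
    rintro (_ | l)
    · exact (hasCircuit_X true none).mono (by omega) (by omega)
    · exact (hasCircuit_C_mul (- W l) (by omega) (h₃ ((l : ℕ) : F))).mono le_rfl le_rfl
  obtain ⟨Ψ, h1, h2, h3, -⟩ := hasCircuit_C_add_sum 0 _ (by omega) h₄
  refine ⟨Ψ, ?_, h2.trans (by simp), h3⟩
  rw [Fintype.sum_option] at h1
  rw [hg, sub_eq_add_neg, ← Finset.sum_neg_distrib]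
  simpa using h1

theorem exists_eq_affine_of_totalDegree_le_one [CommSemiring F] {n : ℕ}
    (g : MvPolynomial (Fin n) F) (hg : g.totalDegree ≤ 1) :
    ∃ (c : F) (a : Fin n → F), g = C c + ∑ i, C (a i) * X i := by
  rw [g.as_sum]
  refine Finset.sum_induction _
    (fun q => ∃ (c : F) (a : Fin n → F), q = C c + ∑ i, C (a i) * X i) ?_ ?_ ?_
  · rintro _ _ ⟨c, a, rfl⟩ ⟨c', a', rfl⟩
    refine ⟨c + c', a + a', ?_⟩
    simp only [Pi.add_apply, map_add, add_mul, Finset.sum_add_distrib]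
    ring
  · exact ⟨0, 0, by simp⟩
  · intro e he
    have h : e.degree ≤ 1 := (le_totalDegree he).trans hg
    rcases Nat.le_one_iff_eq_zero_or_eq_one.1 h with h | h
    · rw [Finsupp.degree_eq_zero_iff] at h
      subst h
      exact ⟨coeff 0 g, 0, by simp⟩
    · obtain ⟨i, rfl⟩ := (Finsupp.sum_eq_one_iff e).1 h
      refine ⟨0, Pi.single i (coeff (Finsupp.single i 1) g), ?_⟩
      rw [Finset.sum_eq_single i]
      · simp [C_mul_X_eq_monomial]
      · intro j _ hj
        simp [hj]
      · simp

/-- For `r ≤ 1` the power `r^k` is at most `1` and cannot absorb a bound depending on `k`. Only this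
case makes the size depend on `n`. -/
theorem exists_circuit_X_sub_rename_of_totalDegree_le_one [Field F] {n : ℕ}
    (g : MvPolynomial (Fin n) F) (hg : g.totalDegree ≤ 1) :
    ∃ Ψ : AlgCircuit F (Option (Fin n)), Ψ.Computes (X none - rename some g) ∧
      Ψ.size ≤ (n + 1) * 3 + 2 ∧ Ψ.depth ≤ 2 := by
  obtain ⟨c, a, rfl⟩ := exists_eq_affine_of_totalDegree_le_one g hg
  have h : ∀ o : Option (Fin n), HasCircuit true
      (C (o.elim 1 fun i => - a i) * X o : MvPolynomial (Option (Fin n)) F) 3 1 :=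
    fun o => hasCircuit_C_mul _ le_rfl (hasCircuit_X false o)
  obtain ⟨Ψ, h1, h2, h3, -⟩ := hasCircuit_C_add_sum (- c) _ (by omega) h
  refine ⟨Ψ, ?_, by simpa using h2, h3⟩
  rw [Fintype.sum_option] at h1
  convert h1 using 1
  simp only [map_add, map_sum, map_mul, rename_C, rename_X, Option.elim_none, Option.elim_some,
    map_neg, neg_mul, Finset.sum_neg_distrib, C_1, one_mul]
  ring

end AlgCircuit

/-- The variables are indexed by `Option (Fin n)`: `none` is `y` and `some i` is `x_i`. -/
theorem mainTheorem8 :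
    ∃ (P : MvPolynomial (Fin 4) ℕ) (c : ℕ),
      ∀ (F : Type*) [Field F] [CharZero F] (n d k r s Δ : ℕ)
        (f : MvPolynomial (Option (Fin n)) F) (Φ : AlgCircuit F (Option (Fin n)))
        (g : MvPolynomial (Fin n) F),
        f ≠ 0 →
        f.totalDegree ≤ d →
        f.degreeOf none ≤ k →
        Φ.Computes f →
        Φ.size = s →
        Φ.depth = Δ →
        (MvPolynomial.X none - MvPolynomial.rename some g) ∣ f →
        g.totalDegree = r →
        ∃ Ψ : AlgCircuit F (Option (Fin n)),
          Ψ.Computes (MvPolynomial.X none - MvPolynomial.rename some g) ∧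
          Ψ.size ≤ MvPolynomial.eval ![s, r ^ k, d, n] P ∧
          Ψ.depth ≤ Δ + c := by
  refine ⟨(MvPolynomial.X 1 * MvPolynomial.X 2 + 2) * (MvPolynomial.X 1 ^ 4 *
    (MvPolynomial.X 1 * ((MvPolynomial.X 1 + 1) * (7 * MvPolynomial.X 0 + 4) + 2) + 2) + 4) + 2 +
    ((MvPolynomial.X 3 + 1) * 3 + 2), 10, ?_⟩
  intro F _ _ n d k r s Δ f Φ g hf hd hk hΦ hs hΔ hdvd hr
  subst hs hΔ
  have hP : MvPolynomial.eval ![Φ.size, r ^ k, d, n] ((MvPolynomial.X 1 * MvPolynomial.X 2 + 2) *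
      (MvPolynomial.X 1 ^ 4 * (MvPolynomial.X 1 * ((MvPolynomial.X 1 + 1) *
      (7 * MvPolynomial.X 0 + 4) + 2) + 2) + 4) + 2 + ((MvPolynomial.X 3 + 1) * 3 + 2)) =
      (r ^ k * d + 2) * ((r ^ k) ^ 4 * (r ^ k * ((r ^ k + 1) * (7 * Φ.size + 4) + 2) + 2) + 4) + 2 +
        ((n + 1) * 3 + 2) := by
    simp
  rw [hP]
  by_cases hr1 : r ≤ 1
  · obtain ⟨Ψ, h1, h2, h3⟩ :=
      AlgCircuit.exists_circuit_X_sub_rename_of_totalDegree_le_one g (hr.trans_le hr1)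
    exact ⟨Ψ, h1, h2.trans (Nat.le_add_left _ _), by omega⟩
  · obtain ⟨Ψ, h1, h2, h3⟩ := AlgCircuit.exists_circuit_X_sub_rename Φ hΦ hf hd hk hdvd hr.le
    refine ⟨Ψ, h1, (h2.trans ?_).trans (Nat.le_add_right _ _), h3⟩
    -- For `k = 0`, `f` does not involve `y`, so vanishing at `y = g` would force `f = 0`.
    have hk1 : k ≠ 0 := by
      rintro rfl
      have h0 := eval_optionEquivLeft_eq_zero hdvd
      have hdeg := MvPolynomial.natDegree_optionEquivLeft F f
      have hC := Polynomial.eq_C_of_natDegree_eq_zero (hdeg.trans (Nat.le_zero.1 hk))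
      rw [hC, Polynomial.eval_C] at h0
      rw [h0, Polynomial.C_0] at hC
      exact hf ((EmbeddingLike.map_eq_zero_iff).1 hC)
    have hrk : r ≤ r ^ k := Nat.le_self_pow hk1 r
    have hkk : k ≤ r ^ k := (Nat.lt_pow_self (by omega)).le
    -- Uses `r + 1 ≤ r^2` for `r ≥ 2` and `k + 1 ≤ 2k` for `k ≥ 1`.
    have hM : (r + 1) ^ (k + 1) ≤ (r ^ k) ^ 4 := by
      calc (r + 1) ^ (k + 1) ≤ (r ^ 2) ^ (2 * k) :=
            (Nat.pow_le_pow_left (by nlinarith) _).trans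
              (Nat.pow_le_pow_right (Nat.pow_pos (by omega)) (by omega))
        _ = (r ^ k) ^ 4 := by rw [← pow_mul, ← pow_mul]; congr 1; ring
    gcongr
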